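/- Let $q\ge 2$ be an integer and let $p\in\mathbb{C}[x]$ be a polynomial with $p(0)=1$. Let $$F(x)=\prod_{s=0}^{\infty}\frac{1}{p(x^{q^s})}=\sum_{i=0}^{\infty}c_i x^i\in\mathbb{C}[[x]],$$ the infinite product being taken in the sense of coefficientwise convergence of formal power series. Suppose that the sequence $(c_i)_{i\ge 0}$ is $q$-regular, i.e. that the $\mathbb{C}$-vector space spanned by its $q$-kernel $\{(c_{q^l n+b})_{n\ge 0} : l\ge 0,\ 0\le b<q^l\}$ is finite-dimensional. Then there is a polynomial $Q\in\mathbb{C}[x]$ with $Q(0)=1$ such that $Q(x)$ divides $Q(x^q)$ and $p(x)$ divides the polynomial $Q(x^q)/Q(x)$. Consequently $$R(x)=\frac{Q(x^q)}{Q(x)\,p(x)}$$ is a polynomial, the product $\prod_{s=0}^{\infty}R(x^{q^s})$ converges coefficientwise, and $$F(x)=Q(x)\prod_{s=0}^{\infty}R(x^{q^s}).$$ -/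

import Mathlib

open Polynomial PowerSeries
open scoped PowerSeries.WithPiTopology

/-- The `q`-kernel of a sequence `a`: the set of all sequences `n ↦ a (q ^ l * n + b)` with
`l : ℕ` and `0 ≤ b < q ^ l`. -/
def qKernel {α : Type*} (q : ℕ) (a : ℕ → α) : Set (ℕ → α) :=
  {u | ∃ l b : ℕ, b < q ^ l ∧ u = fun n => a (q ^ l * n + b)}

/-- A complex sequence is `q`-regular if its `q`-kernel generates a finitely generated
(that is, finite-dimensional) complex vector space of sequences. -/
def IsQRegular (q : ℕ) (a : ℕ → ℂ) : Prop :=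
  (Submodule.span ℂ (qKernel q a)).FG

/-- The polynomial `f (x ^ q ^ s)`, regarded as a formal power series. -/
noncomputable def powSubst (q s : ℕ) (f : ℂ[X]) : ℂ⟦X⟧ :=
  ((Polynomial.expand ℂ (q ^ s) f : ℂ[X]) : ℂ⟦X⟧)

/-! The product satisfies `F(x^q) = p(x) F(x)`. Let `V` be the span of the `q`-kernel of `F`. Each
kernel series is `F` times a rational function with no pole at `0`; as `V` is finite-dimensional, a
common denominator exists, and the minimal one, `Q`, generates `denominatorIdeal F V`. Since `V` is
stable under the Cartier operators, `Q(x^q)` carries `V` into `F(x^q) ℂ[x] = p F ℂ[x]`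
(`exists_expand_mul_eq`). As `F` lies in `V`, `p` divides `Q(x^q)`, and the quotient is again a
denominator of `V`, so `Q` divides it: `Q(x^q) = Q p R`. Finally `F` and `Q ∏ R(x^{q^s})` solve the
same equation with constant term `1`, which forces equality. -/

/-- The series `∑ f_{N n + b} x ^ n`, the Cartier operator of index `b` modulo `N`. -/
noncomputable def cartier (N b : ℕ) (f : ℂ⟦X⟧) : ℂ⟦X⟧ :=
  PowerSeries.mk fun n => PowerSeries.coeff (N * n + b) f

/-! ### Cartier operators -/

theorem cartier_expand_mul {N b : ℕ} (hN : N ≠ 0) (hb : b < N) (f g : ℂ⟦X⟧) :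
    cartier N b (PowerSeries.expand N hN f * g) = f * cartier N b g := by
  ext n
  have hN0 : 0 < N := Nat.pos_of_ne_zero hN
  simp only [cartier, PowerSeries.coeff_mk, PowerSeries.coeff_mul]
  symm
  refine Finset.sum_of_injOn (fun x => (N * x.1, N * x.2 + b)) ?_ ?_ ?_ ?_
  · rintro ⟨a, c⟩ _ ⟨a', c'⟩ _ h
    simpa [hN] using h
  · rintro ⟨a, c⟩ h
    simp only [Finset.mem_coe, Finset.HasAntidiagonal.mem_antidiagonal] at h ⊢
    rw [← h]; ring
  · rintro ⟨i, j⟩ h h'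
    rw [Finset.HasAntidiagonal.mem_antidiagonal] at h
    by_cases hi : N ∣ i
    · exfalso
      obtain ⟨k, rfl⟩ := hi
      -- Here `b < N` is essential: `k > n` would give `N * k > N * n + b`.
      have hk : k ≤ n := by
        by_contra! hk
        have : N * (n + 1) ≤ N * k := Nat.mul_le_mul_left _ hk
        rw [mul_add] at this
        omega
      obtain ⟨m, rfl⟩ := Nat.exists_eq_add_of_le hk
      refine h' ⟨(k, m), by simp, ?_⟩
      rw [mul_add] at h
      simp only [Prod.mk.injEq, true_and]
      omega
    · rw [PowerSeries.coeff_expand_of_not_dvd N hN _ hi, zero_mul]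
  · rintro ⟨a, c⟩ _
    simp [PowerSeries.coeff_expand_mul]

theorem sum_X_pow_mul_expand_cartier {N : ℕ} (hN : N ≠ 0) (f : ℂ⟦X⟧) :
    ∑ b ∈ Finset.range N, (PowerSeries.X : ℂ⟦X⟧) ^ b * PowerSeries.expand N hN (cartier N b f)
      = f := by
  have hN0 : 0 < N := Nat.pos_of_ne_zero hN
  ext m
  rw [map_sum, Finset.sum_eq_single (m % N)]
  · rw [PowerSeries.coeff_X_pow_mul', if_pos (Nat.mod_le _ _),
      show m - m % N = N * (m / N) by have := Nat.div_add_mod m N; omega,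
      PowerSeries.coeff_expand_mul, cartier, PowerSeries.coeff_mk, Nat.div_add_mod]
  · intro b hb hbm
    rw [PowerSeries.coeff_X_pow_mul']
    split_ifs with h
    · apply PowerSeries.coeff_expand_of_not_dvd
      rintro ⟨k, hk⟩
      apply hbm
      rw [show m = b + N * k by omega, Nat.add_mul_mod_self_left,
        Nat.mod_eq_of_lt (Finset.mem_range.mp hb)]
    · rfl
  · intro h
    exact absurd (Finset.mem_range.mpr (Nat.mod_lt m hN0)) h

theorem exists_polynomial_eq_cartier {N : ℕ} (hN : N ≠ 0) (b : ℕ) (f : ℂ[X]) :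
    ∃ r : ℂ[X], (r : ℂ⟦X⟧) = cartier N b (f : ℂ⟦X⟧) := by
  refine ⟨PowerSeries.trunc (f.natDegree + 1) (cartier N b (f : ℂ⟦X⟧)), ?_⟩
  ext n
  rw [Polynomial.coeff_coe, PowerSeries.coeff_trunc]
  split_ifs with h
  · rfl
  · rw [cartier, PowerSeries.coeff_mk, Polynomial.coeff_coe,
      Polynomial.coeff_eq_zero_of_natDegree_lt]
    have := Nat.le_mul_of_pos_left n (Nat.pos_of_ne_zero hN)
    omega

theorem coe_polynomial_expand {N : ℕ} (hN : N ≠ 0) (f : ℂ[X]) :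
    ((Polynomial.expand ℂ N f : ℂ[X]) : ℂ⟦X⟧) = PowerSeries.expand N hN (f : ℂ⟦X⟧) := by
  ext n
  rw [Polynomial.coeff_coe, Polynomial.coeff_expand (Nat.pos_of_ne_zero hN),
    PowerSeries.coeff_expand]
  simp

/-! ### The substitution `x ↦ x^q` and infinite products -/

theorem powSubst_zero (q : ℕ) (f : ℂ[X]) : powSubst q 0 f = (f : ℂ⟦X⟧) := by
  simp [powSubst]

theorem powSubst_succ {q : ℕ} (hq : q ≠ 0) (s : ℕ) (f : ℂ[X]) :
    powSubst q (s + 1) f = PowerSeries.expand q hq (powSubst q s f) := by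
  rw [powSubst, powSubst, pow_succ', Polynomial.expand_mul, coe_polynomial_expand hq]

theorem constantCoeff_coe_eq_eval (f : ℂ[X]) :
    PowerSeries.constantCoeff (f : ℂ⟦X⟧) = f.eval 0 := by
  rw [← PowerSeries.coeff_zero_eq_constantCoeff_apply, Polynomial.coeff_coe,
    Polynomial.coeff_zero_eq_eval_zero]

theorem constantCoeff_powSubst {q : ℕ} (hq : q ≠ 0) (s : ℕ) (f : ℂ[X]) :
    PowerSeries.constantCoeff (powSubst q s f) = f.eval 0 := by
  rw [powSubst, constantCoeff_coe_eq_eval, Polynomial.expand_eval,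
    zero_pow (pow_ne_zero s hq)]

theorem expand_inv {N : ℕ} (hN : N ≠ 0) (f : ℂ⟦X⟧) (hf : PowerSeries.constantCoeff f ≠ 0) :
    PowerSeries.expand N hN f⁻¹ = (PowerSeries.expand N hN f)⁻¹ := by
  rw [PowerSeries.eq_inv_iff_mul_eq_one (by simpa using hf), ← map_mul,
    PowerSeries.inv_mul_cancel _ hf, map_one]

theorem continuous_expand {N : ℕ} (hN : N ≠ 0) :
    Continuous (PowerSeries.expand (R := ℂ) N hN) := by
  refine continuous_iff_continuousAt.mpr fun f => ?_
  rw [ContinuousAt, PowerSeries.WithPiTopology.tendsto_iff_coeff_tendsto]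
  intro n
  simp only [PowerSeries.coeff_expand]
  split_ifs
  · exact (PowerSeries.WithPiTopology.continuous_coeff ℂ _).continuousAt
  · exact tendsto_const_nhds

/-- A product `∏ f_s` whose factors satisfy `f_{s+1}(x) = f_s(x ^ q)` solves
`F(x) = f_0(x) F(x ^ q)`. -/
theorem HasProd.eq_mul_expand {q : ℕ} (hq : q ≠ 0) {f : ℕ → ℂ⟦X⟧} {F : ℂ⟦X⟧}
    (hf : ∀ s, f (s + 1) = PowerSeries.expand q hq (f s)) (hF : HasProd f F) :
    F = f 0 * PowerSeries.expand q hq F := by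
  have h := hF.map (PowerSeries.expand q hq) (continuous_expand hq)
  have h' : HasProd (fun s => f (s + 1)) (PowerSeries.expand q hq F) := by
    simpa only [Function.comp_def, ← hf] using h
  exact hF.unique h'.zero_mul

theorem HasProd.constantCoeff_eq_one {f : ℕ → ℂ⟦X⟧} {F : ℂ⟦X⟧}
    (hf : ∀ s, PowerSeries.constantCoeff (f s) = 1) (hF : HasProd f F) :
    PowerSeries.constantCoeff F = 1 := by
  have h := hF.map (PowerSeries.constantCoeff (R := ℂ))
    (PowerSeries.WithPiTopology.continuous_constantCoeff ℂ)
  refine h.unique ?_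
  simp [Function.comp_def, hf]

/-- A series without constant term that solves `p(x) D(x) = D(x ^ q)` vanishes. -/
theorem eq_zero_of_mul_eq_expand {q : ℕ} (hq : 2 ≤ q) {p D : ℂ⟦X⟧}
    (hp : PowerSeries.constantCoeff p ≠ 0) (hD : PowerSeries.constantCoeff D = 0)
    (h : p * D = PowerSeries.expand q (by omega) D) : D = 0 := by
  by_contra hne
  -- As `p` is a unit, `ord D = q * ord D`, impossible for `0 < ord D < ∞`.
  have h1 := congrArg PowerSeries.order h
  rw [PowerSeries.order_mul, PowerSeries.order_expand,
    PowerSeries.order_zero_of_unit (PowerSeries.isUnit_iff_constantCoeff.mpr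
      (isUnit_iff_ne_zero.mpr hp)), zero_add] at h1
  obtain ⟨d, hd⟩ := ENat.ne_top_iff_exists.mp (mt PowerSeries.order_eq_top.mp hne)
  have h0 : D.order ≠ 0 := by
    rwa [PowerSeries.order_ne_zero_iff_constCoeff_eq_zero]
  rw [← hd] at h1 h0
  rw [nsmul_eq_mul] at h1
  norm_cast at h1 h0
  nlinarith [Nat.pos_of_ne_zero h0]

theorem multipliable_powSubst {q : ℕ} (hq : 2 ≤ q) (R : ℂ[X]) (hR : R.eval 0 = 1) :
    Multipliable fun s : ℕ => powSubst q s R := by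
  have key : ∀ s : ℕ, powSubst q s R = 1 + powSubst q s (R - 1) := fun s => by
    simp [powSubst]
  simp_rw [key]
  apply PowerSeries.WithPiTopology.multipliable_one_add_of_tendsto_order_atTop_nhds_top
  refine ENat.tendsto_nhds_top_iff_natCast_lt.mpr fun n =>
    Filter.eventually_atTop.mpr ⟨n, fun s hs => ?_⟩
  have hqs : q ^ s ≠ 0 := pow_ne_zero s (by omega)
  rw [powSubst, coe_polynomial_expand hqs, PowerSeries.order_expand]
  have h1 : 1 ≤ ((R - 1 : ℂ[X]) : ℂ⟦X⟧).order := by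
    rw [Order.one_le_iff_ne_zero, PowerSeries.order_ne_zero_iff_constCoeff_eq_zero,
      constantCoeff_coe_eq_eval]
    simp [hR]
  have h2 : n < q ^ s := hs.trans_lt (Nat.lt_pow_self (by omega))
  calc (n : ℕ∞) < (q ^ s : ℕ) := by exact_mod_cast h2
    _ = (q ^ s) • (1 : ℕ∞) := by simp
    _ ≤ _ := nsmul_le_nsmul_right h1 _

/-! ### Denominators of the `q`-kernel -/

/-- Every polynomial `A` with `A(0) ≠ 0` divides some `B(x ^ N)` with `B(0) ≠ 0`. -/
theorem exists_dvd_expand (N : ℕ) (A : ℂ[X]) (hA : A.eval 0 ≠ 0) :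
    ∃ B : ℂ[X], B.eval 0 ≠ 0 ∧ A ∣ Polynomial.expand ℂ N B := by
  have hs := IsAlgClosed.splits A
  -- Each root `a` is replaced by `a ^ N`, because `x - a` divides `x^N - a^N`.
  refine ⟨Polynomial.C A.leadingCoeff *
    (A.roots.map fun a => Polynomial.X - Polynomial.C (a ^ N)).prod, ?_, ?_⟩
  · rw [Polynomial.eval_mul, Polynomial.eval_C, Polynomial.eval_multiset_prod]
    have hA0 : A ≠ 0 := by rintro rfl; simp at hA
    refine mul_ne_zero (Polynomial.leadingCoeff_ne_zero.mpr hA0) ?_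
    rw [Ne, Multiset.prod_eq_zero_iff]
    simp only [Multiset.map_map, Multiset.mem_map, Function.comp_apply, Polynomial.eval_sub,
      Polynomial.eval_X, Polynomial.eval_C, zero_sub, neg_eq_zero]
    rintro ⟨a, ha, h⟩
    rw [eq_zero_of_pow_eq_zero h] at ha
    exact hA (Polynomial.isRoot_of_mem_roots ha)
  · conv_lhs => rw [hs.eq_prod_roots]
    rw [map_mul, Polynomial.expand_C, map_multiset_prod, Multiset.map_map]
    refine mul_dvd_mul_left _ (Multiset.prod_dvd_prod_of_dvd _ _ fun a _ => ?_)
    simpa using sub_dvd_pow_sub_pow (Polynomial.X : ℂ[X]) (Polynomial.C a) N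

/-- The polynomials `a` with `a v ∈ F ℂ[x]` for every `v ∈ V`. -/
def denominatorIdeal (F : ℂ⟦X⟧) (V : Submodule ℂ (ℕ → ℂ)) : Ideal ℂ[X] where
  carrier := {a | ∀ v ∈ V, ∃ r : ℂ[X], (a : ℂ⟦X⟧) * PowerSeries.mk v = F * (r : ℂ⟦X⟧)}
  add_mem' := by
    intro a b ha hb v hv
    obtain ⟨r, hr⟩ := ha v hv
    obtain ⟨s, hs⟩ := hb v hv
    exact ⟨r + s, by rw [Polynomial.coe_add, Polynomial.coe_add, add_mul, hr, hs, mul_add]⟩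
  zero_mem' := fun v _ => ⟨0, by simp⟩
  smul_mem' := by
    intro c a ha v hv
    obtain ⟨r, hr⟩ := ha v hv
    refine ⟨c * r, ?_⟩
    rw [smul_eq_mul, Polynomial.coe_mul, Polynomial.coe_mul, mul_assoc, hr]
    ring

theorem mem_denominatorIdeal_span {F : ℂ⟦X⟧} {T : Set (ℕ → ℂ)} {a : ℂ[X]}
    (h : ∀ v ∈ T, ∃ r : ℂ[X], (a : ℂ⟦X⟧) * PowerSeries.mk v = F * (r : ℂ⟦X⟧)) :
    a ∈ denominatorIdeal F (Submodule.span ℂ T) := by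
  intro v hv
  induction hv using Submodule.span_induction with
  | mem v hv => exact h v hv
  | zero => exact ⟨0, by ext; simp [PowerSeries.coeff_mul]⟩
  | add v w _ _ hv hw =>
    obtain ⟨r, hr⟩ := hv
    obtain ⟨s, hs⟩ := hw
    refine ⟨r + s, ?_⟩
    rw [Polynomial.coe_add, mul_add, ← hr, ← hs, ← mul_add]
    rfl
  | smul c v _ hv =>
    obtain ⟨r, hr⟩ := hv
    refine ⟨c • r, ?_⟩
    rw [Polynomial.coe_smul, mul_smul_comm, ← hr, ← mul_smul_comm]
    rfl

theorem expand_pow_eq_prod_mul {q : ℕ} (hq : q ≠ 0) {p : ℂ[X]} {F : ℂ⟦X⟧}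
    (hF : PowerSeries.expand q hq F = p * F) (l : ℕ) :
    PowerSeries.expand (q ^ l) (pow_ne_zero l hq) F =
      ((∏ s ∈ Finset.range l, Polynomial.expand ℂ (q ^ s) p : ℂ[X]) : ℂ⟦X⟧) * F := by
  induction l with
  | zero => simp
  | succ l ih =>
    have h : PowerSeries.expand (q ^ (l + 1)) (pow_ne_zero (l + 1) hq) F =
        PowerSeries.expand (q ^ l) (pow_ne_zero l hq) (PowerSeries.expand q hq F) := by
      rw [← PowerSeries.expand_mul]
      congr 1
    rw [h, hF, map_mul, ih, Finset.prod_range_succ, Polynomial.coe_mul,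
      coe_polynomial_expand (pow_ne_zero l hq)]
    ring

/-- With `N = q^l`, choose `B` with `B(x^N) = C ∏ p(x^{q^s})`, `s < l`. Then `B(x^N) F = F(x^N) C`,
and the Cartier operator pulls out both `B` and `F`. -/
theorem exists_denominator_of_mem_qKernel {q : ℕ} (hq : q ≠ 0) {p : ℂ[X]} (hp : p.eval 0 ≠ 0)
    {F : ℂ⟦X⟧} (hF : PowerSeries.expand q hq F = p * F) {v : ℕ → ℂ}
    (hv : v ∈ qKernel q fun n => PowerSeries.coeff n F) :
    ∃ B : ℂ[X], B.eval 0 ≠ 0 ∧ ∃ r : ℂ[X], (B : ℂ⟦X⟧) * PowerSeries.mk v = F * (r : ℂ⟦X⟧) := by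
  obtain ⟨l, b, hb, rfl⟩ := hv
  have hN : q ^ l ≠ 0 := pow_ne_zero l hq
  obtain ⟨B, hB, C, hC⟩ := exists_dvd_expand (q ^ l)
    (∏ s ∈ Finset.range l, Polynomial.expand ℂ (q ^ s) p) (by
      rw [Polynomial.eval_prod, Finset.prod_ne_zero_iff]
      intro s _
      rwa [Polynomial.expand_eval, zero_pow (pow_ne_zero s hq)])
  obtain ⟨r, hr⟩ := exists_polynomial_eq_cartier hN b C
  refine ⟨B, hB, r, ?_⟩
  calc (B : ℂ⟦X⟧) * cartier (q ^ l) b F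
      = cartier (q ^ l) b (PowerSeries.expand (q ^ l) hN F * C) := by
        rw [← cartier_expand_mul hN hb, ← coe_polynomial_expand hN, hC,
          expand_pow_eq_prod_mul hq hF, Polynomial.coe_mul]
        congr 1
        ring
    _ = F * (r : ℂ⟦X⟧) := by rw [cartier_expand_mul hN hb, hr]

theorem exists_mem_denominatorIdeal {F : ℂ⟦X⟧} {T : Set (ℕ → ℂ)}
    (hfg : (Submodule.span ℂ T).FG)
    (h : ∀ v ∈ T, ∃ B : ℂ[X], B.eval 0 ≠ 0 ∧
      ∃ r : ℂ[X], (B : ℂ⟦X⟧) * PowerSeries.mk v = F * (r : ℂ⟦X⟧)) :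
    ∃ B ∈ denominatorIdeal F (Submodule.span ℂ T), B.eval 0 ≠ 0 := by
  obtain ⟨S, hST, hS⟩ := (Submodule.fg_span_iff_fg_span_finset_subset T).mp hfg
  choose! B hB h' using h
  refine ⟨∏ v ∈ S, B v, ?_, ?_⟩
  · rw [hS]
    refine mem_denominatorIdeal_span fun v hv => ?_
    obtain ⟨c, hc⟩ := Finset.dvd_prod_of_mem B hv
    obtain ⟨r, hr⟩ := h' v (hST hv)
    refine ⟨c * r, ?_⟩
    rw [hc, mul_comm (B v), Polynomial.coe_mul, mul_assoc, hr, Polynomial.coe_mul]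
    ring
  · rw [Polynomial.eval_prod, Finset.prod_ne_zero_iff]
    exact fun v hv => hB v (hST hv)

theorem span_qKernel_stable {q : ℕ} {a : ℕ → ℂ} {b : ℕ} (hb : b < q) {v : ℕ → ℂ}
    (hv : v ∈ Submodule.span ℂ (qKernel q a)) :
    (fun n => v (q * n + b)) ∈ Submodule.span ℂ (qKernel q a) := by
  have h : Submodule.span ℂ (qKernel q a) ≤ (Submodule.span ℂ (qKernel q a)).comap
      (LinearMap.funLeft ℂ ℂ fun n => q * n + b) := by
    rw [Submodule.span_le]
    rintro _ ⟨l, c, hc, rfl⟩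
    refine Submodule.subset_span ⟨l + 1, q ^ l * b + c, ?_, ?_⟩
    · calc q ^ l * b + c < q ^ l * b + q ^ l := by omega
        _ = q ^ l * (b + 1) := by ring
        _ ≤ q ^ l * q := Nat.mul_le_mul_left _ hb
        _ = q ^ (l + 1) := (pow_succ q l).symm
    · funext n
      simp only [LinearMap.funLeft_apply]
      congr 1
      ring
  exact h hv

/-- Split `v` into its sections modulo `q`, each of which lies in `V`, and substitute `x^q` in the
relation that `Q` gives for each section. -/
theorem exists_expand_mul_eq {q : ℕ} (hq : q ≠ 0) {p Q : ℂ[X]} {F : ℂ⟦X⟧}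
    (hF : PowerSeries.expand q hq F = p * F) {V : Submodule ℂ (ℕ → ℂ)}
    (hV : ∀ b < q, ∀ v ∈ V, (fun n => v (q * n + b)) ∈ V) (hQ : Q ∈ denominatorIdeal F V)
    {v : ℕ → ℂ} (hv : v ∈ V) :
    ∃ r : ℂ[X], ((Polynomial.expand ℂ q Q : ℂ[X]) : ℂ⟦X⟧) * PowerSeries.mk v = p * F * r := by
  have h : ∀ b < q, ∃ r : ℂ[X], (Q : ℂ⟦X⟧) * cartier q b (PowerSeries.mk v) = F * r := by
    intro b hb
    obtain ⟨r, hr⟩ := hQ _ (hV b hb v hv)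
    refine ⟨r, hr ▸ ?_⟩
    congr 1
    ext n
    simp [cartier]
  choose! r hr using h
  refine ⟨∑ b ∈ Finset.range q, Polynomial.X ^ b * Polynomial.expand ℂ q (r b), ?_⟩
  have hsum : ((∑ b ∈ Finset.range q, Polynomial.X ^ b * Polynomial.expand ℂ q (r b) : ℂ[X]) : ℂ⟦X⟧)
      = ∑ b ∈ Finset.range q, (PowerSeries.X : ℂ⟦X⟧) ^ b * PowerSeries.expand q hq (r b) := by
    rw [← Polynomial.coeToPowerSeries.ringHom_apply, map_sum]
    simp [coe_polynomial_expand hq]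
  rw [hsum, ← sum_X_pow_mul_expand_cartier hq (PowerSeries.mk v), Finset.mul_sum, Finset.mul_sum]
  refine Finset.sum_congr rfl fun b hb => ?_
  rw [coe_polynomial_expand hq, ← hF, mul_left_comm, ← map_mul, hr b (Finset.mem_range.mp hb),
    map_mul]
  ring

/-- If `F` is `q`-regular and `F(x ^ q) = p(x) F(x)`, then `Q(x ^ q)` is divisible by
`p(x) Q(x)` for some `Q` with `Q(0) = 1`. -/
theorem exists_expand_eq_mul_of_isQRegular {q : ℕ} (hq : q ≠ 0) {p : ℂ[X]} (hp : p.eval 0 ≠ 0)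
    {F : ℂ⟦X⟧} (hF0 : F ≠ 0) (hF : PowerSeries.expand q hq F = p * F)
    (hreg : IsQRegular q fun n => PowerSeries.coeff n F) :
    ∃ Q R : ℂ[X], Q.eval 0 = 1 ∧ Polynomial.expand ℂ q Q = Q * (p * R) := by
  set V := Submodule.span ℂ (qKernel q fun n => PowerSeries.coeff n F)
  obtain ⟨B, hBI, hB⟩ := exists_mem_denominatorIdeal hreg fun v hv =>
    exists_denominator_of_mem_qKernel hq hp hF hv
  obtain ⟨Q₀, hQ₀⟩ := (IsPrincipalIdealRing.principal (denominatorIdeal F V)).principal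
  have hmem : ∀ a, a ∈ denominatorIdeal F V ↔ Q₀ ∣ a := fun a => by
    rw [hQ₀]; exact Ideal.mem_span_singleton
  have hQ₀0 : Q₀.eval 0 ≠ 0 := fun h => hB <| by
    obtain ⟨c, hc⟩ := (hmem B).mp hBI
    rw [hc, Polynomial.eval_mul, h, zero_mul]
  have hstable : ∀ b < q, ∀ v ∈ V, (fun n => v (q * n + b)) ∈ V :=
    fun b hb v hv => span_qKernel_stable hb hv
  have hexp := fun v (hv : v ∈ V) =>
    exists_expand_mul_eq hq hF hstable ((hmem Q₀).mpr dvd_rfl) hv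
  have hFV : (fun n => PowerSeries.coeff n F) ∈ V :=
    Submodule.subset_span ⟨0, 0, by simp, by simp⟩
  have hmk : PowerSeries.mk (fun n => PowerSeries.coeff n F) = F := by ext; simp
  obtain ⟨r, hr⟩ := hexp _ hFV
  have hr' : Polynomial.expand ℂ q Q₀ = p * r := by
    rw [hmk, mul_right_comm] at hr
    exact_mod_cast mul_right_cancel₀ hF0 hr
  have hp0 : (p : ℂ⟦X⟧) ≠ 0 := by
    rw [Ne, Polynomial.coe_eq_zero_iff]
    rintro rfl
    simp at hp
  -- Cancelling `p` from `p r v ∈ p F ℂ[x]` shows that `r` is itself a denominator.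
  have hrI : r ∈ denominatorIdeal F V := by
    intro v hv
    obtain ⟨t, ht⟩ := hexp v hv
    refine ⟨t, mul_left_cancel₀ hp0 ?_⟩
    rw [← mul_assoc, ← mul_assoc, ← ht, hr', Polynomial.coe_mul]
  obtain ⟨R, rfl⟩ := (hmem r).mp hrI
  refine ⟨Polynomial.C (Q₀.eval 0)⁻¹ * Q₀, R, by simp [hQ₀0], ?_⟩
  rw [map_mul, Polynomial.expand_C, hr']
  ring

/-- Infinite products of formal power series are taken in `ℂ⟦X⟧` with the topology of
coefficientwise convergence. -/
theorem mainTheorem9 (q : ℕ) (hq : 2 ≤ q) (p : ℂ[X]) (hp : p.eval 0 = 1)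
    (F : ℂ⟦X⟧) (hF : HasProd (fun s : ℕ => (powSubst q s p)⁻¹) F)
    (hreg : IsQRegular q (fun n => PowerSeries.coeff n F)) :
    ∃ Q S R : ℂ[X], Q.eval 0 = 1 ∧
      Polynomial.expand ℂ q Q = Q * S ∧ S = p * R ∧
      ∃ G : ℂ⟦X⟧, HasProd (fun s : ℕ => powSubst q s R) G ∧ F = (Q : ℂ⟦X⟧) * G := by
  have hq0 : q ≠ 0 := by omega
  have hps : ∀ s, PowerSeries.constantCoeff (powSubst q s p) = 1 := fun s => by
    rw [constantCoeff_powSubst hq0, hp]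
  have hpc : PowerSeries.constantCoeff (p : ℂ⟦X⟧) = 1 := by rw [constantCoeff_coe_eq_eval, hp]
  have hF1 : PowerSeries.constantCoeff F = 1 := hF.constantCoeff_eq_one fun s => by simp [hps]
  have hFe : PowerSeries.expand q hq0 F = p * F := by
    have h := hF.eq_mul_expand hq0 fun s => by
      rw [powSubst_succ hq0, expand_inv hq0 _ (by simp [hps])]
    simp only [powSubst_zero] at h
    conv_rhs => rw [h]
    rw [← mul_assoc, PowerSeries.mul_inv_cancel _ (by simp [hpc]), one_mul]
  obtain ⟨Q, R, hQ, hQR⟩ := exists_expand_eq_mul_of_isQRegular hq0 (by simp [hp])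
    (by rintro rfl; simp at hF1) hFe hreg
  have hR : R.eval 0 = 1 := by
    have h := congrArg (Polynomial.eval 0) hQR
    simpa [Polynomial.expand_eval, zero_pow hq0, hQ, hp] using h.symm
  obtain ⟨G, hG⟩ := multipliable_powSubst hq R hR
  refine ⟨Q, p * R, R, hQ, hQR, rfl, G, hG, ?_⟩
  have hG1 : PowerSeries.constantCoeff G = 1 := hG.constantCoeff_eq_one fun s => by
    rw [constantCoeff_powSubst hq0, hR]
  have hGe := hG.eq_mul_expand hq0 (powSubst_succ hq0 · R)
  rw [powSubst_zero] at hGe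
  -- `D = F - Q G` has zero constant term and satisfies `p D = D(x^q)`, since `Q(x^q) G(x^q) = Q p R
  -- G(x^q) = p Q G`.
  refine sub_eq_zero.mp (eq_zero_of_mul_eq_expand hq (p := p) (by simp [hpc]) ?_ ?_)
  · rw [map_sub, map_mul, hF1, hG1, constantCoeff_coe_eq_eval, hQ]
    simp
  · rw [map_sub, map_mul, hFe, ← coe_polynomial_expand hq0, hQR, Polynomial.coe_mul,
      Polynomial.coe_mul, mul_sub]
    conv_lhs => rw [hGe]
    ring
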